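/- All graphs are finite, simple and undirected. For a graph $H$, a graph is $H$-free if it has no induced subgraph isomorphic to $H$. Let $P_5$ be the path on five vertices, and let the diamond be the complete graph $K_4$ minus one edge. In the game of cops and robber on a connected graph, first each of $k$ cops is placed on a vertex (several cops may share a vertex), then the robber chooses a vertex, and then the cops and the robber move alternately, the cops first, with full information; in a turn of the cops each cop, and in a turn of the robber the robber, stays at its vertex or moves to an adjacent one. The cops win if after finitely many turns some cop and the robber are at the same vertex; otherwise the robber wins. The cop number $\mathrm{cop}(G)$ of a graph $G$ is the minimum $k$ such that $k$ cops have a winning strategy in each connected component of $G$. Theorem. Let $G$ be a connected graph that is both $P_5$-free and diamond-free. Then $\mathrm{cop}(G)\le 2$. -/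

import Mathlib

namespace CopsRobber

universe u

variable {V : Type u}

/-- A valid move of a single player (a cop or the robber) from `x` to `y`:
stay at the current vertex or go to an adjacent one. -/
def IsMove (G : SimpleGraph V) (x y : V) : Prop :=
  x = y ∨ G.Adj x y

/-- A (history dependent) strategy of a team of `k` cops on `G`. The cops choose their initial
vertices (several cops may share a vertex); afterwards `move h c` is the new position of the team
when it is the cops' turn, the cops are at `c` and `h` is the list of all positions
of the robber so far, the current one first. Every cop makes a valid move. -/
structure CopStrategy (G : SimpleGraph V) (k : ℕ) where
  start : Fin k → V
  move : List V → (Fin k → V) → (Fin k → V)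
  move_valid : ∀ h c i, IsMove G (c i) (move h c i)

/-- The list `[r n, ..., r 1, r 0]` of the first `n + 1` positions of the robber. -/
def history (r : ℕ → V) : ℕ → List V
  | 0 => [r 0]
  | n + 1 => r (n + 1) :: history r n

/-- A play of the robber on `G`: an initial vertex `r 0`, followed by valid moves. -/
def IsRobberPlay (G : SimpleGraph V) (r : ℕ → V) : Prop :=
  ∀ n, IsMove G (r n) (r (n + 1))

/-- The position of the cops after `n` of their moves, when they follow the strategy `σ`
and the robber plays `r`. The order of the turns is: `cops 0`, `r 0`, `cops 1`, `r 1`, .... -/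
def CopStrategy.cops {G : SimpleGraph V} {k : ℕ} (σ : CopStrategy G k) (r : ℕ → V) :
    ℕ → Fin k → V
  | 0 => σ.start
  | n + 1 => σ.move (history r n) (σ.cops r n)

/-- The strategy `σ` wins if against every play of the robber, after finitely many turns a cop and
the robber are at the same vertex: either just after the robber's turn that takes it to `r n`,
or just after the cops' turn that follows. -/
def CopStrategy.Wins {G : SimpleGraph V} {k : ℕ} (σ : CopStrategy G k) : Prop :=
  ∀ r : ℕ → V, IsRobberPlay G r →
    ∃ (n : ℕ) (i : Fin k), σ.cops r n i = r n ∨ σ.cops r (n + 1) i = r n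

/-- `k` cops win the game on `G`. -/
def CopsWin (G : SimpleGraph V) (k : ℕ) : Prop :=
  ∃ σ : CopStrategy G k, σ.Wins

/-- The cop number of `G`: the minimum number `k` such that `k` cops win in each
connected component of `G` (it is `⊤` if there is no such `k`). -/
noncomputable def copNumber (G : SimpleGraph V) : ℕ∞ :=
  ⨅ (k : ℕ) (_ : ∀ C : G.ConnectedComponent, CopsWin C.toSimpleGraph k), (k : ℕ∞)

/-- The diamond: the complete graph on four vertices minus one edge. -/
def diamond : SimpleGraph (Fin 4) :=
  (⊤ : SimpleGraph (Fin 4)).deleteEdges {s(0, 1)}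

/-- `G` is `H`-free: no induced subgraph of `G` is isomorphic to `H`. -/
def IndFree {W : Type*} (H : SimpleGraph W) (G : SimpleGraph V) : Prop :=
  ¬ H.IsIndContained G

end CopsRobber

namespace CopsRobber

variable {V : Type*} {G : SimpleGraph V}

/-! Two cops on an edge `u v` win in at most four moves. The core, `forcedWin_of_adj_left`, treats a
robber at `d` having a neighbour adjacent to `u` but not to `v`. Diamond-freeness makes the common
neighbours of `u` and `d` independent, likewise for `v`, and `P₅`-freeness controls the edges
between these sets and the robber's escapes. `forcedWin_of_adj` reaches this configuration in at
most one move, since `P₅`-freeness bounds distances by 3. A bounded forced win from every robber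
position yields a strategy. -/

/-- The team at `c`, to move, can catch the robber at `r` within `n` of its moves. -/
def ForcedWin (G : SimpleGraph V) {k : ℕ} : ℕ → (Fin k → V) → V → Prop
  | 0, _, _ => False
  | n + 1, c, r => ∃ c' : Fin k → V, (∀ i, IsMove G (c i) (c' i)) ∧
      ((∃ i, c' i = r) ∨ ∀ r', IsMove G r r' → (∃ i, c' i = r') ∨ ForcedWin G n c' r')

theorem ForcedWin.mono_succ {k : ℕ} {n : ℕ} {c : Fin k → V} {r : V} (h : ForcedWin G n c r) :
    ForcedWin G (n + 1) c r := by
  induction n generalizing c r with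
  | zero => exact h.elim
  | succ n ih =>
    obtain ⟨c', hc, h⟩ := h
    exact ⟨c', hc, h.imp_right fun h r' hr => (h r' hr).imp_right ih⟩

theorem ForcedWin.mono {k : ℕ} {m n : ℕ} {c : Fin k → V} {r : V} (h : ForcedWin G m c r)
    (hmn : m ≤ n) : ForcedWin G n c r := by
  induction hmn with
  | refl => exact h
  | step _ ih => exact ih.mono_succ

theorem IsMove.refl (x : V) : IsMove G x x := Or.inl rfl

theorem forcedWin_of_isMove {n : ℕ} {a b r : V} (h : IsMove G a r ∨ IsMove G b r) :
    ForcedWin G (n + 1) ![a, b] r := by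
  rcases h with h | h
  · refine ⟨![r, b], ?_, Or.inl ⟨0, rfl⟩⟩
    intro i
    fin_cases i
    exacts [h, IsMove.refl b]
  · refine ⟨![a, r], ?_, Or.inl ⟨1, rfl⟩⟩
    intro i
    fin_cases i
    exacts [IsMove.refl a, h]

theorem forcedWin_step {n : ℕ} {a b a' b' r : V} (ha : IsMove G a a') (hb : IsMove G b b')
    (h : ∀ r', IsMove G r r' → ¬ IsMove G a' r' → ¬ IsMove G b' r' →
      ForcedWin G (n + 1) ![a', b'] r') :
    ForcedWin G (n + 2) ![a, b] r := by
  refine ⟨![a', b'], ?_, Or.inr fun r' hr => Or.inr ?_⟩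
  · intro i
    fin_cases i
    exacts [ha, hb]
  · by_cases h1 : IsMove G a' r' ∨ IsMove G b' r'
    · exact forcedWin_of_isMove h1
    · push Not at h1
      exact h r' hr h1.1 h1.2

open Classical in
/-- The team's move that realises the least level of a forced win (stay put if there is none). -/
noncomputable def bestMove (G : SimpleGraph V) {k : ℕ} (c : Fin k → V) (r : V) : Fin k → V :=
  if h : ∃ n, ForcedWin G (n + 1) c r then (Nat.find_spec h).choose else c

theorem bestMove_valid {k : ℕ} (c : Fin k → V) (r : V) (i : Fin k) :
    IsMove G (c i) (bestMove G c r i) := by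
  classical
  unfold bestMove
  split_ifs with h
  · exact (Nat.find_spec h).choose_spec.1 i
  · exact IsMove.refl _

theorem bestMove_spec {k n : ℕ} {c : Fin k → V} {r : V} (h : ForcedWin G (n + 1) c r) :
    (∃ i, bestMove G c r i = r) ∨ ∀ r', IsMove G r r' →
      (∃ i, bestMove G c r i = r') ∨ ForcedWin G n (bestMove G c r) r' := by
  classical
  have h' : ∃ n, ForcedWin G (n + 1) c r := ⟨n, h⟩
  have hs := (Nat.find_spec h').choose_spec.2
  have hb : bestMove G c r = (Nat.find_spec h').choose := by
    unfold bestMove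
    rw [dif_pos h']
  rw [← hb] at hs
  exact hs.imp_right fun H r' hr => (H r' hr).imp_right fun H =>
    H.mono (Nat.find_min' h' h)

/-- The strategy that always plays `bestMove`. -/
noncomputable def bestStrategy (G : SimpleGraph V) {k : ℕ} (c : Fin k → V) : CopStrategy G k where
  start := c
  move h c := match h with
    | [] => c
    | r :: _ => bestMove G c r
  move_valid h c i := by
    cases h with
    | nil => exact IsMove.refl _
    | cons r _ => exact bestMove_valid c r i

theorem bestStrategy_cops_succ {k : ℕ} (c : Fin k → V) (r : ℕ → V) (m : ℕ) :
    (bestStrategy G c).cops r (m + 1) = bestMove G ((bestStrategy G c).cops r m) (r m) := by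
  cases m <;> rfl

/-- Playing for the least level lowers any valid level by one per turn, so a memoryless strategy
suffices. -/
theorem copsWin_of_forcedWin {k : ℕ} {c : Fin k → V} (h : ∀ r, ∃ n, ForcedWin G n c r) :
    CopsWin G k := by
  refine ⟨bestStrategy G c, fun r hr => ?_⟩
  have key : ∀ n m, ForcedWin G n ((bestStrategy G c).cops r m) (r m) →
      ∃ (n : ℕ) (i : Fin k), (bestStrategy G c).cops r n i = r n ∨
        (bestStrategy G c).cops r (n + 1) i = r n := by
    intro n
    induction n with
    | zero => exact fun m h => h.elim
    | succ n ih =>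
      intro m h
      have hs := bestMove_spec h
      rw [← bestStrategy_cops_succ] at hs
      rcases hs with ⟨i, hi⟩ | hs
      · exact ⟨m, i, Or.inr hi⟩
      · rcases hs _ (hr m) with ⟨i, hi⟩ | hs
        · exact ⟨m + 1, i, Or.inl hi⟩
        · exact ih _ hs
  obtain ⟨n, hn⟩ := h (r 0)
  exact key n 0 hn

/-! ### Forbidden induced subgraphs -/

theorem IndFree.of_embedding {U W : Type*} {H : SimpleGraph W} {G' : SimpleGraph U}
    (h : IndFree H G) (f : G' ↪g G) : IndFree H G' :=
  fun ⟨g⟩ => h ⟨f.comp g⟩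

theorem IndFree.false_of_path (h : IndFree (SimpleGraph.pathGraph 5) G) {a b c d e : V}
    (hab : G.Adj a b) (hbc : G.Adj b c) (hcd : G.Adj c d) (hde : G.Adj d e)
    (hac : ¬ G.Adj a c) (had : ¬ G.Adj a d) (hae : ¬ G.Adj a e)
    (hbd : ¬ G.Adj b d) (hbe : ¬ G.Adj b e) (hce : ¬ G.Adj c e) : False := by
  have key : ∀ i j : Fin 5, G.Adj (![a, b, c, d, e] i) (![a, b, c, d, e] j) ↔
      (SimpleGraph.pathGraph 5).Adj i j := by
    intro i j
    rw [SimpleGraph.pathGraph_adj]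
    fin_cases i <;> fin_cases j <;> simp [*, G.adj_comm]
  -- Distinct vertices of `P₅` have distinct neighbourhoods, so the adjacency pattern alone forces
  -- the five vertices to be distinct.
  have hinj : ∀ i j : Fin 5, (∀ l : Fin 5, (i.val + 1 = l.val ∨ l.val + 1 = i.val) ↔
      (j.val + 1 = l.val ∨ l.val + 1 = j.val)) → i = j := by decide
  refine h ⟨⟨⟨![a, b, c, d, e], ?_⟩, @fun i j => key i j⟩⟩
  intro i j hij
  have hk : ∀ l, (SimpleGraph.pathGraph 5).Adj i l ↔ (SimpleGraph.pathGraph 5).Adj j l := by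
    intro l
    rw [← key, ← key, hij]
  simp only [SimpleGraph.pathGraph_adj] at hk
  exact hinj i j hk

theorem IndFree.adj_of_diamond (h : IndFree diamond G) {a b c d : V} (hab : a ≠ b)
    (hcd : G.Adj c d) (hac : G.Adj a c) (had : G.Adj a d) (hbc : G.Adj b c) (hbd : G.Adj b d) :
    G.Adj a b := by
  by_contra hn
  have hn' : ¬ G.Adj b a := fun h => hn h.symm
  have key : ∀ i j : Fin 4, G.Adj (![a, b, c, d] i) (![a, b, c, d] j) ↔ diamond.Adj i j := by
    intro i j
    fin_cases i <;> fin_cases j <;>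
      simp [diamond, hn, hn', hac, had, hbc, hbd, hcd, hac.symm, had.symm, hbc.symm, hbd.symm,
        hcd.symm]
  refine h ⟨⟨⟨![a, b, c, d], ?_⟩, @fun i j => key i j⟩⟩
  intro i j hij
  fin_cases i <;> fin_cases j <;> simp_all

/-! ### The two-cop endgame -/

/-- Cops at adjacent `u` and `v` win if some neighbour of the robber is adjacent to `u` only. -/
theorem forcedWin_of_adj_left (hP : IndFree (SimpleGraph.pathGraph 5) G) (hD : IndFree diamond G)
    {u v d x : V} (huv : G.Adj u v) (hux : G.Adj u x) (hxd : G.Adj x d) (hxv : ¬ G.Adj v x) :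
    ForcedWin G 3 ![u, v] d := by
  by_cases hnear : IsMove G u d ∨ IsMove G v d
  · exact forcedWin_of_isMove hnear
  simp only [IsMove, not_or] at hnear
  obtain ⟨⟨hud', hud⟩, hvd', hvd⟩ := hnear
  -- If `d` has a neighbour `e` seen by neither cop, moving `u` to `x` leaves no escape: every
  -- private common neighbour of `u` and `d` is adjacent to every such `e`.
  by_cases hE : ∃ e, G.Adj d e ∧ ¬ G.Adj u e ∧ ¬ G.Adj v e
  · obtain ⟨e, hde, hue, hve⟩ := hE
    have hcomplete : ∀ y, G.Adj u y → ¬ G.Adj v y → G.Adj y d → ∀ e, G.Adj d e → ¬ G.Adj u e →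
        ¬ G.Adj v e → G.Adj y e := fun y huy hvy hyd e hde hue hve => by
      by_contra hye
      exact hP.false_of_path huv.symm huy hyd hde hvy hvd hve hud hue hye
    refine ForcedWin.mono (forcedWin_step (n := 0) (Or.inr hux) (IsMove.refl v) ?_)
      (by norm_num)
    intro r hr hxr hvr
    simp only [IsMove, not_or] at hxr hvr
    rcases hr with rfl | hr
    · exact absurd hxd hxr.2
    by_cases hur : G.Adj u r
    · exact absurd (hD.adj_of_diamond hxr.1 hde hxd (hcomplete x hux hxv hxd e hde hue hve)
        hr.symm (hcomplete r hur hvr.2 hr.symm e hde hue hve)) hxr.2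
    · exact absurd (hcomplete x hux hxv hxd r hr hur hvr.2) hxr.2
  push Not at hE
  by_cases hB : ∃ y, G.Adj v y ∧ G.Adj y d ∧ ¬ G.Adj u y
  swap
  · push Not at hB
    refine ForcedWin.mono (forcedWin_step (n := 0) (Or.inr hux) (Or.inr huv.symm) ?_)
      (by norm_num)
    intro r hr hxr hur
    simp only [IsMove, not_or] at hxr hur
    rcases hr with rfl | hr
    · exact absurd hxd hxr.2
    · exact absurd (hB r (hE r hr hur.2) hr.symm) hur.2
  obtain ⟨y, hvy, hyd, huy⟩ := hB
  by_cases hB2 : ∃ y', y' ≠ y ∧ G.Adj v y' ∧ G.Adj y' d ∧ ¬ G.Adj u y'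
  swap
  · push Not at hB2
    refine ForcedWin.mono (forcedWin_step (n := 0) (IsMove.refl u) (Or.inr hvy) ?_)
      (by norm_num)
    intro r hr hur hyr
    simp only [IsMove, not_or] at hyr hur
    rcases hr with rfl | hr
    · exact absurd hyd hyr.2
    · exact absurd (hB2 r (Ne.symm hyr.1) (hE r hr hur.2) hr.symm) hur.2
  obtain ⟨y', hyy', hvy', hyd', huy'⟩ := hB2
  have indepA : ∀ a b, G.Adj u a → G.Adj a d → G.Adj u b → G.Adj b d → ¬ G.Adj a b :=
    fun a b hua had hub hbd hab => hud (hD.adj_of_diamond hud' hab hua hub had.symm hbd.symm)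
  have indepB : ∀ a b, G.Adj v a → G.Adj a d → G.Adj v b → G.Adj b d → ¬ G.Adj a b :=
    fun a b hua had hub hbd hab => hvd (hD.adj_of_diamond hvd' hab hua hub had.symm hbd.symm)
  -- There is at most one edge `x₁y₁` between the private sides of `u` and `v`: a second one,
  -- `x₂y₂`, would give an induced path `y₁x₁ux₂y₂`. Taking `x₁` on this edge, if it exists, leaves
  -- the other `x₂` without neighbours on the side of `v`.
  obtain ⟨x₁, hux₁, hx₁d, hvx₁, hunm⟩ : ∃ x₁, G.Adj u x₁ ∧ G.Adj x₁ d ∧ ¬ G.Adj v x₁ ∧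
      ∀ x₂ y₂, x₂ ≠ x₁ → G.Adj u x₂ → G.Adj x₂ d → ¬ G.Adj v x₂ →
        G.Adj v y₂ → G.Adj y₂ d → ¬ G.Adj u y₂ → ¬ G.Adj x₂ y₂ := by
    by_cases hm : ∃ x₁ y₁, G.Adj u x₁ ∧ G.Adj x₁ d ∧ ¬ G.Adj v x₁ ∧ G.Adj v y₁ ∧ G.Adj y₁ d ∧
        ¬ G.Adj u y₁ ∧ G.Adj x₁ y₁
    · obtain ⟨x₁, y₁, hux₁, hx₁d, hvx₁, hvy₁, hy₁d, huy₁, hxy₁⟩ := hm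
      refine ⟨x₁, hux₁, hx₁d, hvx₁, fun x₂ y₂ hne hux₂ hx₂d hvx₂ hvy₂ hy₂d huy₂ hxy₂ => ?_⟩
      have h12 : ¬ G.Adj x₁ x₂ := indepA _ _ hux₁ hx₁d hux₂ hx₂d
      have hy12 : ¬ G.Adj y₁ y₂ := indepB _ _ hvy₁ hy₁d hvy₂ hy₂d
      have hyx : ¬ G.Adj x₂ y₁ := fun h =>
        h12 (hD.adj_of_diamond hne.symm hy₁d hxy₁ hx₁d h hx₂d)
      have hxy : ¬ G.Adj x₁ y₂ := fun h =>
        h12 (hD.adj_of_diamond hne.symm hy₂d h hx₁d hxy₂ hx₂d)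
      exact hP.false_of_path hxy₁.symm hux₁.symm hux₂ hxy₂ (fun h => huy₁ h.symm)
        (fun h => hyx h.symm) hy12 h12 hxy huy₂
    · push Not at hm
      exact ⟨x, hux, hxd, hxv, fun x₂ y₂ _ h1 h2 h3 h4 h5 h6 => hm x₂ y₂ h1 h2 h3 h4 h5 h6⟩
  -- By diamond-freeness `x₁` is adjacent to at most one of `y`, `y'`.
  obtain ⟨y₀, hvy₀, hy₀d, huy₀, hx₁y₀⟩ :
      ∃ y₀, G.Adj v y₀ ∧ G.Adj y₀ d ∧ ¬ G.Adj u y₀ ∧ ¬ G.Adj x₁ y₀ := by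
    by_cases h1 : G.Adj x₁ y
    · refine ⟨y', hvy', hyd', huy', fun h2 => ?_⟩
      exact indepB _ _ hvy' hyd' hvy hyd
        (hD.adj_of_diamond hyy' hx₁d h2.symm hyd' h1.symm hyd)
    · exact ⟨y, hvy, hyd, huy, h1⟩
  refine forcedWin_step (Or.inr hux₁) (IsMove.refl v) ?_
  intro x₂ hr hx₁₂ hvx₂
  simp only [IsMove, not_or] at hx₁₂ hvx₂
  rcases hr with rfl | hdx₂
  · exact absurd hx₁d hx₁₂.2
  have hux₂ : G.Adj u x₂ := by
    by_contra h
    exact hvx₂.2 (hE x₂ hdx₂ h)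
  have hx₂y : ∀ y₂, G.Adj v y₂ → G.Adj y₂ d → ¬ G.Adj u y₂ → ¬ G.Adj x₂ y₂ := fun y₂ =>
    hunm x₂ y₂ (Ne.symm hx₁₂.1) hux₂ hdx₂.symm hvx₂.2
  -- The robber is now at `x₂`, on the side of `u`. The cop at `v` returns to `u`, and any escape
  -- `z` would create an induced `P₅`.
  refine forcedWin_step (n := 0) (IsMove.refl x₁) (Or.inr huv.symm) ?_
  intro z hr hx₁z huz
  exfalso
  simp only [IsMove, not_or] at hx₁z huz
  rcases hr with rfl | hx₂z
  · exact huz.2 hux₂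
  have hdz : ¬ G.Adj d z := fun h => hx₂y z (hE z h huz.2) h.symm huz.2 hx₂z
  have hzv : ¬ G.Adj z v := fun h =>
    hP.false_of_path hx₁d hdx₂ hx₂z h hx₁₂.2 hx₁z.2 (fun h => hvx₁ h.symm) hdz
      (fun h => hvd h.symm) (fun h => hvx₂.2 h.symm)
  have hx₂y₀ := hx₂y y₀ hvy₀ hy₀d huy₀
  have hzy₀ : G.Adj z y₀ := by
    by_contra h
    exact hP.false_of_path hx₂z.symm hdx₂.symm hy₀d.symm hvy₀.symm (fun h => hdz h.symm) h hzv
      hx₂y₀ (fun h => hvx₂.2 h.symm) (fun h => hvd h.symm)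
  exact hP.false_of_path hux₁.symm hux₂ hx₂z hzy₀ hx₁₂.2 hx₁z.2 hx₁y₀ huz.2 huy₀ hx₂y₀

/-! ### Reaching the endgame from any edge -/

theorem exists_adj_dist_eq (hG : G.Connected) {a d : V} {n : ℕ} (h : G.dist a d = n + 1) :
    ∃ b, G.Adj a b ∧ G.dist b d = n := by
  obtain ⟨p, hp⟩ := hG.exists_walk_length_eq_dist a d
  cases p with
  | nil => simp at h
  | cons hab q =>
    rename_i b
    refine ⟨b, hab, ?_⟩
    have h1 := SimpleGraph.dist_le q
    have h2 := hG.dist_triangle (u := a) (v := b) (w := d)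
    rw [SimpleGraph.dist_eq_one_iff_adj.2 hab] at h2
    simp only [SimpleGraph.Walk.length_cons] at hp
    omega

theorem dist_le_dist_add_one (hG : G.Connected) {a b d : V} (h : G.Adj a b) :
    G.dist a d ≤ G.dist b d + 1 := by
  have h2 := hG.dist_triangle (u := a) (v := b) (w := d)
  rw [SimpleGraph.dist_eq_one_iff_adj.2 h] at h2
  omega

theorem exists_path_of_far (hG : G.Connected) (hP : IndFree (SimpleGraph.pathGraph 5) G)
    {u d : V} (h : ¬ IsMove G u d) (hc : ∀ w, G.Adj u w → ¬ G.Adj w d) :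
    ∃ a b, G.Adj u a ∧ G.Adj a b ∧ G.Adj b d ∧ ¬ G.Adj u b ∧ ¬ G.Adj a d := by
  simp only [IsMove, not_or] at h
  have hne {a b : V} (h : G.dist b d + 2 ≤ G.dist a d) : ¬ G.Adj a b := fun hab => by
    have := dist_le_dist_add_one hG (d := d) hab
    omega
  rcases hn : G.dist u d with _ | _ | _ | n
  · exact absurd (hG.dist_eq_zero_iff.1 hn) h.1
  · exact absurd (SimpleGraph.dist_eq_one_iff_adj.1 hn) h.2
  · obtain ⟨w, h1, h2⟩ := exists_adj_dist_eq hG hn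
    exact absurd (SimpleGraph.dist_eq_one_iff_adj.1 h2) (hc w h1)
  obtain ⟨a, hua, ha⟩ := exists_adj_dist_eq hG hn
  obtain ⟨b, hab, hb⟩ := exists_adj_dist_eq hG ha
  obtain ⟨c, hbc, hc'⟩ := exists_adj_dist_eq hG hb
  rcases n with _ | n
  · obtain rfl := hG.dist_eq_zero_iff.1 hc'
    exact ⟨a, b, hua, hab, hbc, hne (by omega), hc a hua⟩
  · obtain ⟨e, hce, he⟩ := exists_adj_dist_eq hG hc'
    exact (hP.false_of_path hua hab hbc hce (hne (by omega)) (hne (by omega)) (hne (by omega))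
      (hne (by omega)) (hne (by omega)) (hne (by omega))).elim

theorem forcedWin_of_adj (hG : G.Connected) (hP : IndFree (SimpleGraph.pathGraph 5) G)
    (hD : IndFree diamond G) {u v : V} (huv : G.Adj u v) (d : V) :
    ForcedWin G 4 ![u, v] d := by
  by_cases hnear : IsMove G u d ∨ IsMove G v d
  · exact forcedWin_of_isMove hnear
  obtain ⟨hud, hvd⟩ := not_or.1 hnear
  by_cases hc : ∃ w, G.Adj u w ∧ G.Adj w d
  · obtain ⟨w, huw, hwd⟩ := hc
    by_cases hvw : G.Adj v w
    -- With cops at `w` and `v`, the robber's old vertex `d` serves as the neighbour adjacent to `w`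
    -- only.
    · refine forcedWin_step (Or.inr huw) (IsMove.refl v) ?_
      intro r hr hwr hvr
      rcases hr with rfl | hr
      · exact absurd (Or.inr hwd) hwr
      · exact forcedWin_of_adj_left hP hD hvw.symm hwd hr fun h => hvd (Or.inr h)
    · exact (forcedWin_of_adj_left hP hD huv huw hwd hvw).mono_succ
  push Not at hc
  obtain ⟨a, b, hua, hab, hbd, hub, had⟩ := exists_path_of_far hG hP hud hc
  refine forcedWin_step (Or.inr hua) (Or.inr huv.symm) ?_
  intro r hr har hur
  simp only [IsMove, not_or] at har hur hud
  rcases hr with rfl | hr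
  · exact forcedWin_of_adj_left hP hD hua.symm hab hbd hub
  · refine forcedWin_of_adj_left hP hD hua.symm hab ?_ hub
    -- After the robber's move, `b` must still be its neighbour, or `u, a, b, d, r` is an induced
    -- path.
    by_contra hbr
    exact hP.false_of_path hua hab hbd hr hub hud.2 hur.2 had har.2 hbr

theorem copsWin_two (hG : G.Connected) (hP : IndFree (SimpleGraph.pathGraph 5) G)
    (hD : IndFree diamond G) : CopsWin G 2 := by
  by_cases h : ∃ u v, G.Adj u v
  · obtain ⟨u, v, huv⟩ := h
    exact copsWin_of_forcedWin (c := ![u, v]) fun d => ⟨4, forcedWin_of_adj hG hP hD huv d⟩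
  · push Not at h
    obtain ⟨v⟩ := hG.nonempty
    refine copsWin_of_forcedWin (c := ![v, v]) fun d => ⟨1, forcedWin_of_isMove (Or.inl ?_)⟩
    left
    obtain ⟨p⟩ := hG.preconnected v d
    cases p with
    | nil => rfl
    | cons hab _ => exact absurd hab (h _ _)

end CopsRobber

theorem theorem6p1p1 {V : Type*} [Finite V] (G : SimpleGraph V) (hconn : G.Connected)
    (hP5 : CopsRobber.IndFree (SimpleGraph.pathGraph 5) G)
    (hdiamond : CopsRobber.IndFree CopsRobber.diamond G) :
    CopsRobber.copNumber G ≤ 2 := by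
  refine iInf₂_le 2 fun C => ?_
  have f : C.toSimpleGraph ↪g G := SimpleGraph.Embedding.induce _
  exact CopsRobber.copsWin_two C.connected_toSimpleGraph (hP5.of_embedding f)
    (hdiamond.of_embedding f)
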